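/- For a rational number $\alpha/\beta$, with $\alpha,\beta$ relatively prime integers and $\beta>0$, let $$\mathrm{size}(\alpha/\beta)=1+\lceil\log_2(|\alpha|+1)\rceil+\lceil\log_2(\beta+1)\rceil,$$ and for $a\in\mathbb{Q}^d$ let $\mathrm{size}(a)=d+\sum_{i=1}^d\mathrm{size}(a_i)$. A rational polytope in $\mathbb{R}^d$ is a non-empty bounded set of the form $\{x\in\mathbb{R}^d : a^i\cdot x\le b_i \text{ for } i=1,\dots,n\}$ with $a^1,\dots,a^n\in\mathbb{Q}^d$ and $b_1,\dots,b_n\in\mathbb{Q}$; its vertices are then rational. The vertex complexity $\nu(P)$ of a rational polytope $P\subset\mathbb{R}^d$ is the smallest number that is at least $d$ and at least the size of every vertex of $P$. The facet complexity $\varphi(P)$ is the smallest number $\varphi\ge d$ for which there are $n$, vectors $a^1,\dots,a^n\in\mathbb{Q}^d$ and numbers $b_1,\dots,b_n\in\mathbb{Q}$ such that $$P=\{x\in\mathbb{R}^d : a^i\cdot x\le b_i \text{ for } i=1,\dots,n\}\quad\text{and}\quad \mathrm{size}(a^i)+\mathrm{size}(b_i)\le\varphi\text{ for } i=1,\dots,n.$$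 Write $\nu(P,Q)=\max\{\nu(P),\nu(Q)\}$, $\varphi(P,Q)=\max\{\varphi(P),\varphi(Q)\}$, and let $d(P,Q)=\inf\{\|p-q\| : p\in P,\ q\in Q\}$ be the Euclidean distance. **Theorem.** If $P$ and $Q$ are disjoint rational polytopes in $\mathbb{R}^d$, then $$d(P,Q)\ge\frac{8}{2^{4\nu(P,Q)(2d)^4}}\qquad\text{and}\qquad d(P,Q)\ge\frac{8}{2^{4\varphi(P,Q)(2d)^6}}.$$ -/

import Mathlib

namespace RationalPolytope

/-- The binary encoding size of a rational number `α / β` in lowest terms with `β > 0`, that is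
`1 + ⌈log₂ (|α| + 1)⌉ + ⌈log₂ (β + 1)⌉`; `Nat.clog 2` is the rounded-up base-two logarithm. -/
def ratSize (x : ℚ) : ℕ :=
  1 + Nat.clog 2 (x.num.natAbs + 1) + Nat.clog 2 (x.den + 1)

/-- The size of a rational vector: the number of its coordinates plus the sum of their sizes. -/
def vecSize {d : ℕ} (a : Fin d → ℚ) : ℕ :=
  d + ∑ j, ratSize (a j)

/-- The set of solutions in `ℝ^d` of the rational system `a i ⬝ x ≤ b i`, `i = 1, …, n`. -/
def solutionSet {d n : ℕ} (a : Fin n → Fin d → ℚ) (b : Fin n → ℚ) :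
    Set (EuclideanSpace ℝ (Fin d)) :=
  {x | ∀ i, ∑ j, (a i j : ℝ) * x j ≤ (b i : ℝ)}

/-- A rational polytope: a non-empty bounded subset of `ℝ^d` that is the set of solutions of
finitely many linear inequalities with rational coefficients. -/
def IsRationalPolytope {d : ℕ} (P : Set (EuclideanSpace ℝ (Fin d))) : Prop :=
  P.Nonempty ∧ Bornology.IsBounded P ∧
    ∃ (n : ℕ) (a : Fin n → Fin d → ℚ) (b : Fin n → ℚ), P = solutionSet a b

/-- The vertex complexity `ν(P)`: the least number that is at least `d` and at least the size of
every vertex (extreme point) of `P`. -/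
noncomputable def vertexComplexity {d : ℕ} (P : Set (EuclideanSpace ℝ (Fin d))) : ℕ :=
  sInf {m : ℕ | d ≤ m ∧
    ∀ v ∈ Set.extremePoints ℝ P, ∃ c : Fin d → ℚ, (∀ j, v j = (c j : ℝ)) ∧ vecSize c ≤ m}

/-- The facet complexity `φ(P)`: the least number `m ≥ d` such that `P` is the set of solutions of
a finite rational system `a i ⬝ x ≤ b i` with `size (a i) + size (b i) ≤ m` for all `i`. -/
noncomputable def facetComplexity {d : ℕ} (P : Set (EuclideanSpace ℝ (Fin d))) : ℕ :=
  sInf {m : ℕ | d ≤ m ∧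
    ∃ (n : ℕ) (a : Fin n → Fin d → ℚ) (b : Fin n → ℚ),
      P = solutionSet a b ∧ ∀ i, vecSize (a i) + ratSize (b i) ≤ m}

/-- The Euclidean distance between two non-empty sets: the infimum of `dist p q` over `p ∈ P` and
`q ∈ Q`. -/
noncomputable def setDist {d : ℕ} (P Q : Set (EuclideanSpace ℝ (Fin d))) : ℝ :=
  sInf (Set.image2 dist P Q)

end RationalPolytope

namespace RationalPolytope

/-! Disjoint polytopes are strictly separated by some `c · x`, which can be scaled to have gap 1.
Then `1 ≤ c · (q - p) ≤ d * max |c j| * dist p q`, so a bound on the entries of `c` bounds the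
distance from below.

By Krein–Milman, separation only has to be imposed at vertices. With each vertex written as `z / D`,
this is an integer system in the `d + 1` unknowns `(r, c)`, with coefficients at most `M`. A
feasible such system has a basic solution, bounded through Cramer's rule by `(d + 1)! * M ^ (d + 1)`
(`exists_bounded_solution`, `exists_bounded_separating_vector`).

The vertex complexity gives `M = 2 ^ ν` directly. For the facet complexity, Cramer's rule on the
inequalities tight at a vertex first gives `M = d ! * 2 ^ (φ * d)`. -/

/-- The coordinates of `x` are integers of absolute value at most `M` over a common positive
denominator that is also at most `M`. -/
def HasBoundedFractions {κ : Type*} (M : ℕ) (x : κ → ℝ) : Prop :=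
  ∃ (D : ℤ) (z : κ → ℤ), 0 < D ∧ D ≤ M ∧ (∀ j, |z j| ≤ M) ∧ ∀ j, (D : ℝ) * x j = z j

/-! ### Cramer's rule with bounds -/

theorem span_eq_top_of_forall_orthogonal {N : ℕ} (R : Set (Fin N → ℝ))
    (h : ∀ y : Fin N → ℝ, (∀ r ∈ R, ∑ j, r j * y j = 0) → y = 0) :
    Submodule.span ℝ R = ⊤ := by
  by_contra hne
  obtain ⟨f, hf0, hf⟩ := Submodule.exists_le_ker_of_lt_top _ (lt_top_iff_ne_top.2 hne)
  have key : ∀ r : Fin N → ℝ, f r = ∑ j, r j * f (Pi.single j 1) := fun r => by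
    conv_lhs => rw [LinearMap.pi_apply_eq_sum_univ f r]
    refine Finset.sum_congr rfl fun j _ => ?_
    rw [smul_eq_mul]
    congr 2
    ext i
    simp [Pi.single_apply, eq_comm]
  have h0 := h (fun j => f (Pi.single j 1)) fun r hr => by
    rw [← key]
    exact hf (Submodule.subset_span hr)
  apply hf0
  ext r
  have := congrFun h0
  simp_all

theorem exists_fun_linearIndependent_of_span_eq_top {N : ℕ} (R : Set (Fin N → ℝ))
    (h : Submodule.span ℝ R = ⊤) :
    ∃ f : Fin N → Fin N → ℝ, (∀ i, f i ∈ R) ∧ LinearIndependent ℝ f := by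
  obtain ⟨f, hf, -, hli⟩ := Submodule.exists_fun_fin_finrank_span_eq ℝ R
  have hN : N = Module.finrank ℝ (Submodule.span ℝ R) := by rw [h]; simp
  exact ⟨f ∘ Fin.cast hN, fun i => hf _, hli.comp _ (Fin.cast_injective hN)⟩

open Nat in
/-- Cramer's rule: the unique solution of an integer system with coefficients bounded by `M` has
coordinates with numerators and a common denominator bounded by `N! * M ^ N`. -/
theorem hasBoundedFractions_of_unique_solution {N : ℕ} (S : Set ((Fin N → ℤ) × ℤ)) (M : ℕ)
    (hM : ∀ s ∈ S, (∀ j, |s.1 j| ≤ M) ∧ |s.2| ≤ M) (x : Fin N → ℝ)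
    (hx : ∀ s ∈ S, ∑ j, (s.1 j : ℝ) * x j = s.2)
    (hS : ∀ y : Fin N → ℝ, (∀ s ∈ S, ∑ j, (s.1 j : ℝ) * y j = 0) → y = 0) :
    HasBoundedFractions (N ! * M ^ N) x := by
  -- Uniqueness makes the rows span, so `N` independent equations can be chosen from `S`.
  obtain ⟨f, hf, hli⟩ := exists_fun_linearIndependent_of_span_eq_top
    ((fun s : (Fin N → ℤ) × ℤ => fun j => (s.1 j : ℝ)) '' S)
    (span_eq_top_of_forall_orthogonal _ fun y hy => hS y fun s hs =>
      hy _ (Set.mem_image_of_mem _ hs))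
  choose s hs hsf using hf
  set B : Matrix (Fin N) (Fin N) ℤ := Matrix.of fun i j => (s i).1 j with hB
  set c : Fin N → ℤ := fun i => (s i).2 with hc
  have hmap : B.map (Int.castRingHom ℝ) = Matrix.of f := by
    ext i j
    simp [hB, ← hsf]
  have hdet : B.det ≠ 0 := by
    have h1 : IsUnit (Matrix.of f) := Matrix.linearIndependent_rows_iff_isUnit.1 hli
    rw [Matrix.isUnit_iff_isUnit_det, isUnit_iff_ne_zero, ← hmap] at h1
    intro h0
    apply h1
    have := (RingHom.map_det (Int.castRingHom ℝ) B).symm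
    rw [h0] at this
    simpa using this
  have hbound : ∀ A : Matrix (Fin N) (Fin N) ℤ, (∀ i j, |A i j| ≤ M) →
      |A.det| ≤ ((N ! * M ^ N : ℕ) : ℤ) := fun A hA => by
    have := Matrix.det_le (A := A) (abv := AbsoluteValue.abs) (x := (M : ℤ)) (by simpa using hA)
    simpa using this
  have hBM : ∀ i j, |B i j| ≤ M := fun i j => (hM _ (hs i)).1 j
  have hcr : ∀ j, (B.det : ℝ) * x j = (B.cramer c j : ℤ) := fun j => by
    have h1 : (B.map (Int.castRingHom ℝ)).mulVec x = fun i => (c i : ℝ) := by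
      ext i
      simpa [Matrix.mulVec, dotProduct, hB, hc] using hx _ (hs i)
    have h2 : ((B.map (Int.castRingHom ℝ)).cramer fun i => (c i : ℝ)) =
        (B.map (Int.castRingHom ℝ)).det • x := by
      rw [← h1, Matrix.cramer_eq_adjugate_mulVec, Matrix.mulVec_mulVec, Matrix.adjugate_mul,
        Matrix.smul_mulVec, Matrix.one_mulVec]
    have h3 := congrFun h2 j
    rw [Matrix.cramer_apply, Pi.smul_apply, smul_eq_mul] at h3
    have h4 : (B.map (Int.castRingHom ℝ)).det = (B.det : ℝ) :=
      (RingHom.map_det (Int.castRingHom ℝ) B).symm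
    have h5 : ((B.map (Int.castRingHom ℝ)).updateCol j fun i => (c i : ℝ)).det =
        ((B.updateCol j c).det : ℤ) := by
      have h6 := RingHom.map_det (Int.castRingHom ℝ) (B.updateCol j c)
      rw [RingHom.mapMatrix_apply, Matrix.map_updateCol] at h6
      exact h6.symm
    rw [← h4, ← h3, h5, Matrix.cramer_apply]
  have hzb : ∀ j, |B.cramer c j| ≤ ((N ! * M ^ N : ℕ) : ℤ) := fun j => by
    rw [Matrix.cramer_apply]
    refine hbound _ fun i k => ?_
    rw [Matrix.updateCol_apply]
    split_ifs
    · exact (hM _ (hs i)).2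
    · exact hBM i k
  -- The sign of the determinant moves to the numerators, keeping the denominator positive.
  refine ⟨|B.det|, fun j => SignType.sign B.det * B.cramer c j, abs_pos.2 hdet, hbound _ hBM,
    fun j => ?_, fun j => ?_⟩
  · rcases lt_or_gt_of_ne hdet with h | h
    · simpa [sign_neg h] using hzb j
    · simpa [sign_pos h] using hzb j
  · rcases lt_or_gt_of_ne hdet with h | h
    · beta_reduce
      rw [abs_of_neg h, sign_neg h, SignType.coe_neg_one, neg_one_mul, Int.cast_neg, Int.cast_neg,
        neg_mul, hcr]
    · beta_reduce
      rw [abs_of_pos h, sign_pos h, SignType.coe_one, one_mul, hcr]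

/-! ### Bounded solutions of integer inequalities -/

/-- Moving from a feasible point towards a target, one stops at a feasible point where either the
target is reached or a new constraint has become tight. -/
theorem exists_step_tight {N : ℕ} (S : Set ((Fin N → ℤ) × ℤ)) (hS : S.Finite) (x y : Fin N → ℝ)
    (hx : ∀ s ∈ S, ∑ j, (s.1 j : ℝ) * x j ≤ s.2) :
    (∀ s ∈ S, ∑ j, (s.1 j : ℝ) * (x j + y j) ≤ s.2) ∨
    ∃ t : ℝ, (∀ s ∈ S, ∑ j, (s.1 j : ℝ) * (x j + t * y j) ≤ s.2) ∧
      ∃ s ∈ S, ∑ j, (s.1 j : ℝ) * (x j + t * y j) = s.2 ∧ ∑ j, (s.1 j : ℝ) * y j ≠ 0 := by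
  by_cases hall : ∀ s ∈ S, ∑ j, (s.1 j : ℝ) * (x j + y j) ≤ s.2
  · exact Or.inl hall
  right
  set u : (Fin N → ℤ) × ℤ → ℝ := fun s => ∑ j, (s.1 j : ℝ) * x j with hu
  set w : (Fin N → ℤ) × ℤ → ℝ := fun s => ∑ j, (s.1 j : ℝ) * y j with hw
  have hlin : ∀ (s : (Fin N → ℤ) × ℤ) (t : ℝ),
      ∑ j, (s.1 j : ℝ) * (x j + t * y j) = u s + t * w s := fun s t => by
    simp only [hu, hw, Finset.mul_sum, ← Finset.sum_add_distrib]
    exact Finset.sum_congr rfl fun j _ => by ring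
  have hlin1 : ∀ s : (Fin N → ℤ) × ℤ, ∑ j, (s.1 j : ℝ) * (x j + y j) = u s + w s := fun s => by
    simpa using hlin s 1
  simp only [hlin, hlin1] at hall ⊢
  push Not at hall
  obtain ⟨s₀, hs₀, hs₀'⟩ := hall
  -- Ratio test: among the constraints violated at `x + y`, the one reached first along the segment.
  obtain ⟨s, ⟨hs, hsw⟩, hmin⟩ := Set.exists_min_image {s ∈ S | (s.2 : ℝ) < u s + w s}
    (fun s => (s.2 - u s) / w s) (hS.subset (Set.sep_subset _ _)) ⟨s₀, hs₀, hs₀'⟩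
  have hwpos : ∀ r ∈ S, (r.2 : ℝ) < u r + w r → 0 < w r := fun r hr h => by
    have := hx r hr
    simp only [hu] at h
    linarith
  have hws := hwpos s hs hsw
  have hus : u s ≤ s.2 := hx s hs
  have ht0 : 0 ≤ (s.2 - u s) / w s := div_nonneg (by linarith) hws.le
  have ht1 : (s.2 - u s) / w s ≤ 1 := by rw [div_le_one hws]; linarith
  refine ⟨(s.2 - u s) / w s, fun r hr => ?_, s, hs, ?_, hws.ne'⟩
  · have hur : u r ≤ r.2 := hx r hr
    by_cases h : (r.2 : ℝ) < u r + w r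
    · have h1 := hmin r ⟨hr, h⟩
      have h2 := hwpos r hr h
      have h3 := (le_div_iff₀ h2).1 h1
      linarith
    · push Not at h
      nlinarith
  · rw [div_mul_cancel₀ _ hws.ne']
    ring

open Nat in
/-- A feasible integer system with coefficients bounded by `M` has a solution with coordinates
bounded by `N! * M ^ N`. -/
theorem exists_bounded_solution {N : ℕ} (S : Set ((Fin N → ℤ) × ℤ)) (M : ℕ) (hM1 : 1 ≤ M)
    (hM : ∀ s ∈ S, (∀ j, |s.1 j| ≤ M) ∧ |s.2| ≤ M)
    (hfeas : ∃ x : Fin N → ℝ, ∀ s ∈ S, ∑ j, (s.1 j : ℝ) * x j ≤ s.2) :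
    ∃ x : Fin N → ℝ, (∀ s ∈ S, ∑ j, (s.1 j : ℝ) * x j ≤ s.2) ∧
      ∀ j, |x j| ≤ ((N ! * M ^ N : ℕ) : ℝ) := by
  have hSfin : S.Finite := by
    refine ((Set.finite_Icc (fun _ : Fin N => -(M : ℤ)) (fun _ => (M : ℤ))).prod
      (Set.finite_Icc (-(M : ℤ)) M)).subset fun s hs => ?_
    obtain ⟨h1, h2⟩ := hM s hs
    exact ⟨⟨fun j => (abs_le.1 (h1 j)).1, fun j => (abs_le.1 (h1 j)).2⟩, abs_le.1 h2⟩
  -- The feasible region may contain lines and so have no vertex. The equations `x k = 0` are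
  -- therefore counted when they happen to hold, without being imposed; a point with a maximal set
  -- of tight relations is then determined by them.
  set W : Set ((Fin N → ℤ) × ℤ) := S ∪ Set.range fun j : Fin N => (Pi.single j (1 : ℤ), (0 : ℤ))
    with hW
  have hWfin : W.Finite := hSfin.union (Set.finite_range _)
  have hWM : ∀ s ∈ W, (∀ j, |s.1 j| ≤ M) ∧ |s.2| ≤ M := by
    rintro s (hs | ⟨k, rfl⟩)
    · exact hM s hs
    · refine ⟨fun j => ?_, by simp⟩
      simp only [Pi.single_apply]
      split_ifs
      · simpa using hM1
      · simp
  have hsingle : ∀ (k : Fin N) (y : Fin N → ℝ),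
      ∑ j, (((Pi.single k (1 : ℤ) : Fin N → ℤ) j : ℤ) : ℝ) * y j = y k := fun k y => by
    simp [Pi.single_apply]
  set T : (Fin N → ℝ) → Set ((Fin N → ℤ) × ℤ) :=
    fun x => {s ∈ W | ∑ j, (s.1 j : ℝ) * x j = s.2} with hT
  obtain ⟨x, hx, hmax⟩ := Set.Finite.exists_maximalFor' T
    {x : Fin N → ℝ | ∀ s ∈ S, ∑ j, (s.1 j : ℝ) * x j ≤ s.2}
    (hWfin.finite_subsets.subset (by
      rintro _ ⟨x, -, rfl⟩
      exact Set.sep_subset _ _)) hfeas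
  have hfrac := hasBoundedFractions_of_unique_solution (T x) M (fun s hs => hWM s hs.1) x
    (fun s hs => hs.2) fun y hy => by
    by_contra hy0
    obtain ⟨k, hk⟩ := Function.ne_iff.1 hy0
    simp only [Pi.zero_apply] at hk
    have hxk : x k ≠ 0 := fun h => hk <| by
      have := hy (Pi.single k 1, 0) ⟨Or.inr ⟨k, rfl⟩, by simpa [hsingle] using h⟩
      simpa [hsingle] using this
    -- Scaled so that coordinate `k` of `x + y'` vanishes. Moving along `y'` keeps all tight
    -- relations; either `x k = 0` or a constraint of `S` becomes newly tight, against maximality.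
    set y' : Fin N → ℝ := fun j => -(x k / y k) * y j with hy'
    have hy'T : ∀ s ∈ T x, ∑ j, (s.1 j : ℝ) * y' j = 0 := fun s hs => by
      have := hy s hs
      calc ∑ j, (s.1 j : ℝ) * y' j = -(x k / y k) * ∑ j, (s.1 j : ℝ) * y j := by
            rw [Finset.mul_sum]
            exact Finset.sum_congr rfl fun j _ => by simp only [hy']; ring
        _ = 0 := by rw [this, mul_zero]
    have hmono : ∀ t : ℝ, T x ⊆ T fun j => x j + t * y' j := fun t s hs => by
      refine ⟨hs.1, ?_⟩
      calc ∑ j, (s.1 j : ℝ) * (x j + t * y' j)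
          = ∑ j, (s.1 j : ℝ) * x j + t * ∑ j, (s.1 j : ℝ) * y' j := by
            rw [Finset.mul_sum, ← Finset.sum_add_distrib]
            exact Finset.sum_congr rfl fun j _ => by ring
        _ = s.2 := by rw [hs.2, hy'T s hs]; ring
    rcases exists_step_tight S hSfin x y' hx with h | ⟨t, ht, s, hs, hst, hsw⟩
    · have h1 := hmax (j := fun j => x j + 1 * y' j) (by simpa using h) (hmono 1)
      have h2 : ((Pi.single k 1, 0) : (Fin N → ℤ) × ℤ) ∈ T fun j => x j + 1 * y' j := by
        refine ⟨Or.inr ⟨k, rfl⟩, ?_⟩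
        rw [hsingle]
        simp only [hy']
        field_simp
        simp
      have h3 := (h1 h2).2
      rw [hsingle] at h3
      exact hxk (by simpa using h3)
    · have h1 := hmax (j := fun j => x j + t * y' j) ht (hmono t)
      exact hsw (hy'T s (h1 ⟨Or.inl hs, hst⟩))
  obtain ⟨D, z, hD0, -, hz, hDz⟩ := hfrac
  refine ⟨x, hx, fun j => ?_⟩
  have h1 : (1 : ℝ) ≤ D := by exact_mod_cast hD0
  have h2 : |(z j : ℝ)| ≤ ((N ! * M ^ N : ℕ) : ℝ) := by exact_mod_cast hz j
  rw [← hDz j, abs_mul, abs_of_pos (by linarith)] at h2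
  nlinarith [abs_nonneg (x j)]

/-! ### Encoding sizes and common denominators -/

theorem HasBoundedFractions.mono {κ : Type*} {M M' : ℕ} {x : κ → ℝ}
    (h : HasBoundedFractions M x) (hM : M ≤ M') : HasBoundedFractions M' x := by
  obtain ⟨D, z, h0, h1, h2, h3⟩ := h
  have hM' : (M : ℤ) ≤ M' := by exact_mod_cast hM
  exact ⟨D, z, h0, h1.trans hM', fun j => (h2 j).trans hM', h3⟩

theorem natAbs_num_mul_den_le (x : ℚ) : (x.num.natAbs + 1) * (x.den + 1) ≤ 2 ^ ratSize x := by
  rw [ratSize, pow_add, pow_add, mul_assoc]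
  have h := Nat.mul_le_mul (Nat.le_pow_clog one_lt_two (x.num.natAbs + 1))
    (Nat.le_pow_clog one_lt_two (x.den + 1))
  omega

/-- The common denominator is the product of all denominators. Each numerator replaces one factor of
it, and every factor is at most `2 ^ ratSize`. -/
theorem hasBoundedFractions_of_ratSize {κ : Type*} [Fintype κ] (x : κ → ℚ) :
    HasBoundedFractions (2 ^ ∑ k, ratSize (x k)) (fun k => (x k : ℝ)) := by
  classical
  have hden : ∀ k, (x k).den ≤ 2 ^ ratSize (x k) := fun k => by
    have := natAbs_num_mul_den_le (x k)
    nlinarith [Nat.zero_le ((x k).num.natAbs * ((x k).den + 1))]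
  have hnum : ∀ k, (x k).num.natAbs ≤ 2 ^ ratSize (x k) := fun k => by
    have := natAbs_num_mul_den_le (x k)
    nlinarith [Nat.zero_le (((x k).num.natAbs + 1) * (x k).den)]
  rw [← Finset.prod_pow_eq_pow_sum]
  refine ⟨((∏ k, (x k).den : ℕ) : ℤ),
    fun j => (x j).num * ((∏ k ∈ Finset.univ.erase j, (x k).den : ℕ) : ℤ), ?_, ?_, fun j => ?_,
    fun j => ?_⟩
  · exact_mod_cast Finset.prod_pos fun k _ => (x k).den_pos
  · exact_mod_cast Finset.prod_le_prod' fun k _ => hden k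
  · rw [abs_mul, Nat.abs_cast, Int.abs_eq_natAbs, ← Nat.cast_mul, Nat.cast_le,
      ← Finset.mul_prod_erase Finset.univ _ (Finset.mem_univ j)]
    exact Nat.mul_le_mul (hnum j) (Finset.prod_le_prod' fun k _ => hden k)
  · rw [← Finset.mul_prod_erase Finset.univ _ (Finset.mem_univ j)]
    have h1 : ((x j).den : ℝ) * (x j : ℝ) = ((x j).num : ℝ) := by
      exact_mod_cast Rat.den_mul_eq_num (x j)
    push_cast
    rw [← h1]
    ring

theorem ratSize_div_le {M : ℕ} {D z : ℤ} (hD0 : 0 < D) (hD : D ≤ M) (hz : |z| ≤ M) :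
    ratSize ((z : ℚ) / D) ≤ 1 + Nat.clog 2 (M + 1) + Nat.clog 2 (M + 1) := by
  have hden : ((z : ℚ) / D).den ≤ M := by
    have h := Rat.den_dvd z D
    rw [Rat.divInt_eq_div] at h
    exact_mod_cast (Int.le_of_dvd hD0 h).trans hD
  have hnum : ((z : ℚ) / D).num.natAbs ≤ M := by
    rcases eq_or_ne z 0 with rfl | hz0
    · simp
    · have h := Rat.num_dvd z hD0.ne'
      rw [Rat.divInt_eq_div] at h
      have h1 := Nat.le_of_dvd (Int.natAbs_pos.2 hz0) (Int.natAbs_dvd_natAbs.2 h)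
      rw [Int.abs_eq_natAbs] at hz
      exact h1.trans (by exact_mod_cast hz)
  unfold ratSize
  gcongr

theorem HasBoundedFractions.exists_rat {d M : ℕ} {x : Fin d → ℝ} (h : HasBoundedFractions M x) :
    ∃ c : Fin d → ℚ, (∀ j, x j = (c j : ℝ)) ∧
      vecSize c ≤ d + d * (1 + Nat.clog 2 (M + 1) + Nat.clog 2 (M + 1)) := by
  obtain ⟨D, z, hD0, hD, hz, hDz⟩ := h
  refine ⟨fun j => (z j : ℚ) / D, fun j => ?_, ?_⟩
  · have : (D : ℝ) ≠ 0 := by exact_mod_cast hD0.ne'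
    push_cast
    rw [← hDz j]
    field_simp
  · unfold vecSize
    gcongr
    refine (Finset.sum_le_card_nsmul _ _ _ fun j _ => ratSize_div_le hD0 hD (hz j)).trans ?_
    simp

/-! ### Vertices of rational polytopes -/

open Nat Filter Topology in
/-- Vertices of a polytope given by a rational system with numerators and denominators of each
inequality bounded by `M`. -/
theorem hasBoundedFractions_of_mem_extremePoints {d n : ℕ} (a : Fin n → Fin d → ℚ) (b : Fin n → ℚ)
    (M : ℕ) (h : ∀ i, HasBoundedFractions M fun k : Option (Fin d) => ((k.elim (b i) (a i) : ℚ) : ℝ))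
    (v : EuclideanSpace ℝ (Fin d)) (hv : v ∈ Set.extremePoints ℝ (solutionSet a b)) :
    HasBoundedFractions (d ! * M ^ d) fun j => v j := by
  choose D z hD0 hDM hz hDz using h
  have hb : ∀ i, (D i : ℝ) * (b i : ℝ) = z i none := fun i => hDz i none
  have ha : ∀ i j, (D i : ℝ) * (a i j : ℝ) = z i (some j) := fun i j => hDz i (some j)
  have hscale : ∀ i (y : Fin d → ℝ),
      ∑ j, (z i (some j) : ℝ) * y j = D i * ∑ j, (a i j : ℝ) * y j := fun i y => by
    rw [Finset.mul_sum]
    exact Finset.sum_congr rfl fun j _ => by rw [← ha, mul_assoc]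
  -- The system consists of the inequalities tight at `v`, cleared of denominators.
  refine hasBoundedFractions_of_unique_solution
    ((fun i => ((fun j => z i (some j), z i none) : (Fin d → ℤ) × ℤ)) ''
      {i | ∑ j, (a i j : ℝ) * v j = b i}) M ?_ _ ?_ ?_
  · rintro _ ⟨i, -, rfl⟩
    exact ⟨fun j => hz i _, hz i _⟩
  · rintro _ ⟨i, hi, rfl⟩
    simp only [hscale, ← hb]
    rw [hi]
  · intro y hy
    have hy' : ∀ i, ∑ j, (a i j : ℝ) * v j = b i → ∑ j, (a i j : ℝ) * y j = 0 := fun i hi => by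
      have := hy _ ⟨i, hi, rfl⟩
      simp only [hscale] at this
      have hD : (D i : ℝ) ≠ 0 := by exact_mod_cast (hD0 i).ne'
      simpa [hD] using this
    have hlin : ∀ i (t : ℝ), ∑ j, (a i j : ℝ) * (v j + t * y j) =
        ∑ j, (a i j : ℝ) * v j + t * ∑ j, (a i j : ℝ) * y j := fun i t => by
      rw [Finset.mul_sum, ← Finset.sum_add_distrib]
      exact Finset.sum_congr rfl fun j _ => by ring
    -- If `y` is orthogonal to all tight normals, small moves along `±y` stay feasible, so
    -- extremality of `v` forces `y = 0`.
    have hev : ∀ᶠ t in 𝓝 (0 : ℝ), v + t • WithLp.toLp 2 y ∈ solutionSet a b := by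
      have : ∀ᶠ t in 𝓝 (0 : ℝ), ∀ i, ∑ j, (a i j : ℝ) * v j + t * ∑ j, (a i j : ℝ) * y j ≤ b i := by
        rw [eventually_all]
        intro i
        rcases (hv.1 i).lt_or_eq with hlt | heq
        · have hc : Continuous fun t : ℝ => ∑ j, (a i j : ℝ) * v j + t * ∑ j, (a i j : ℝ) * y j := by
            fun_prop
          have := hc.tendsto 0
          simp only [zero_mul, add_zero] at this
          exact (this.eventually_lt_const hlt).mono fun t ht => ht.le
        · exact Eventually.of_forall fun t => by rw [hy' i heq, heq, mul_zero, add_zero]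
      filter_upwards [this] with t ht i
      have := ht i
      rw [← hlin] at this
      simpa using this
    have hneg : ∀ᶠ t in 𝓝 (0 : ℝ), v + (-t) • WithLp.toLp 2 y ∈ solutionSet a b := by
      have : Tendsto (fun t : ℝ => -t) (𝓝 0) (𝓝 0) := by simpa using (continuous_neg.tendsto (0 : ℝ))
      exact this.eventually hev
    obtain ⟨t, ⟨h1, h2⟩, ht⟩ := ((hev.and hneg).filter_mono nhdsWithin_le_nhds |>.and
      (self_mem_nhdsWithin : Set.Ioi (0 : ℝ) ∈ 𝓝[>] 0)).exists
    have hmid : v ∈ openSegment ℝ (v + t • WithLp.toLp 2 y) (v + (-t) • WithLp.toLp 2 y) := by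
      refine ⟨1 / 2, 1 / 2, by norm_num, by norm_num, by norm_num, ?_⟩
      module
    have heq := hv.2 h1 h2 hmid
    have h0 : t • WithLp.toLp 2 y = 0 := by simpa using heq
    have ht' : t ≠ 0 := ne_of_gt ht
    have h3 : WithLp.toLp 2 y = 0 := (smul_eq_zero.1 h0).resolve_left ht'
    ext j
    simpa using congrArg (fun w : EuclideanSpace ℝ (Fin d) => w j) h3

theorem hasBoundedFractions_of_facet_size {d n m : ℕ} (a : Fin n → Fin d → ℚ) (b : Fin n → ℚ)
    (h : ∀ i, vecSize (a i) + ratSize (b i) ≤ m) (i : Fin n) :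
    HasBoundedFractions (2 ^ m) fun k : Option (Fin d) => ((k.elim (b i) (a i) : ℚ) : ℝ) := by
  refine (hasBoundedFractions_of_ratSize fun k : Option (Fin d) => k.elim (b i) (a i)).mono
    (Nat.pow_le_pow_right two_pos ?_)
  have := h i
  unfold vecSize at this
  rw [Fintype.sum_option]
  simp only [Option.elim]
  omega

theorem vertexComplexity_spec {d : ℕ} {P : Set (EuclideanSpace ℝ (Fin d))}
    (hP : IsRationalPolytope P) : d ≤ vertexComplexity P ∧ ∀ v ∈ Set.extremePoints ℝ P,
      HasBoundedFractions (2 ^ vertexComplexity P) fun j => v j := by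
  obtain ⟨h1, h2⟩ : vertexComplexity P ∈ {m : ℕ | d ≤ m ∧
      ∀ v ∈ Set.extremePoints ℝ P, ∃ c : Fin d → ℚ, (∀ j, v j = (c j : ℝ)) ∧ vecSize c ≤ m} := by
    -- The infimum is attained only if the set is non-empty; any inequality description gives a
    -- uniform bound on the vertex sizes.
    refine Nat.sInf_mem ?_
    obtain ⟨-, -, n, a, b, rfl⟩ := hP
    refine ⟨_, Nat.le_add_right d _, fun v hv =>
      (hasBoundedFractions_of_mem_extremePoints a b _ (hasBoundedFractions_of_facet_size a b
        fun i => Finset.single_le_sum (f := fun i => vecSize (a i) + ratSize (b i))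
          (fun _ _ => Nat.zero_le _) (Finset.mem_univ i)) v hv).exists_rat⟩
  refine ⟨h1, fun v hv => ?_⟩
  obtain ⟨c, hc, hcs⟩ := h2 v hv
  simp only [hc]
  refine (hasBoundedFractions_of_ratSize c).mono (Nat.pow_le_pow_right two_pos ?_)
  unfold vecSize at hcs
  omega

open Nat in
theorem facetComplexity_spec {d : ℕ} {P : Set (EuclideanSpace ℝ (Fin d))}
    (hP : IsRationalPolytope P) : d ≤ facetComplexity P ∧ ∀ v ∈ Set.extremePoints ℝ P,
      HasBoundedFractions (d ! * (2 ^ facetComplexity P) ^ d) fun j => v j := by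
  obtain ⟨h1, n, a, b, hab, h2⟩ : facetComplexity P ∈ {m : ℕ | d ≤ m ∧
      ∃ (n : ℕ) (a : Fin n → Fin d → ℚ) (b : Fin n → ℚ),
        P = solutionSet a b ∧ ∀ i, vecSize (a i) + ratSize (b i) ≤ m} := by
    refine Nat.sInf_mem ?_
    obtain ⟨-, -, n, a, b, hab⟩ := hP
    exact ⟨d + ∑ i, (vecSize (a i) + ratSize (b i)), Nat.le_add_right _ _, n, a, b, hab,
      fun i => (Finset.single_le_sum (f := fun i => vecSize (a i) + ratSize (b i))
        (fun _ _ => Nat.zero_le _) (Finset.mem_univ i)).trans (Nat.le_add_left _ _)⟩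
  refine ⟨h1, fun v hv => ?_⟩
  rw [hab] at hv
  exact hasBoundedFractions_of_mem_extremePoints a b _ (hasBoundedFractions_of_facet_size a b h2) v hv

/-! ### Separation with bounded coefficients -/

theorem continuous_sum_mul {d : ℕ} (c : Fin d → ℝ) :
    Continuous fun x : EuclideanSpace ℝ (Fin d) => ∑ j, c j * x j := by
  fun_prop

theorem convex_sum_mul_le {d : ℕ} (c : Fin d → ℝ) (r : ℝ) :
    Convex ℝ {x : EuclideanSpace ℝ (Fin d) | ∑ j, c j * x j ≤ r} := by
  refine convex_halfSpace_le ⟨fun x y => ?_, fun t x => ?_⟩ r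
  · simp [mul_add, Finset.sum_add_distrib]
  · simp only [PiLp.smul_apply, smul_eq_mul, Finset.mul_sum]
    exact Finset.sum_congr rfl fun j _ => by ring

theorem isClosed_sum_mul_le {d : ℕ} (c : Fin d → ℝ) (r : ℝ) :
    IsClosed {x : EuclideanSpace ℝ (Fin d) | ∑ j, c j * x j ≤ r} :=
  isClosed_le (continuous_sum_mul c) continuous_const

theorem IsRationalPolytope.isCompact {d : ℕ} {P : Set (EuclideanSpace ℝ (Fin d))}
    (hP : IsRationalPolytope P) : IsCompact P := by
  obtain ⟨-, hbd, n, a, b, rfl⟩ := hP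
  refine Metric.isCompact_of_isClosed_isBounded ?_ hbd
  rw [solutionSet, Set.ofPred_forall]
  exact isClosed_iInter fun i => isClosed_sum_mul_le _ _

theorem IsRationalPolytope.convex {d : ℕ} {P : Set (EuclideanSpace ℝ (Fin d))}
    (hP : IsRationalPolytope P) : Convex ℝ P := by
  obtain ⟨-, -, n, a, b, rfl⟩ := hP
  rw [solutionSet, Set.ofPred_forall]
  exact convex_iInter fun i => convex_sum_mul_le _ _

/-- By Krein–Milman, the closed half-space contains the closed convex hull of the extreme points. -/
theorem sum_mul_le_of_extremePoints {d : ℕ} {P : Set (EuclideanSpace ℝ (Fin d))}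
    (hc : IsCompact P) (hconv : Convex ℝ P) (c : Fin d → ℝ) (r : ℝ)
    (h : ∀ v ∈ Set.extremePoints ℝ P, ∑ j, c j * v j ≤ r) : ∀ p ∈ P, ∑ j, c j * p j ≤ r := by
  have h1 : closure (convexHull ℝ (Set.extremePoints ℝ P)) ⊆
      {x : EuclideanSpace ℝ (Fin d) | ∑ j, c j * x j ≤ r} :=
    closure_minimal (convexHull_min h (convex_sum_mul_le c r)) (isClosed_sum_mul_le c r)
  rw [closure_convexHull_extremePoints hc hconv] at h1
  exact h1

theorem exists_separating_vector {d : ℕ} {P Q : Set (EuclideanSpace ℝ (Fin d))}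
    (hPc : IsCompact P) (hP : Convex ℝ P) (hQc : IsCompact Q) (hQ : Convex ℝ Q)
    (hPQ : Disjoint P Q) : ∃ (c : Fin d → ℝ) (r : ℝ),
      (∀ p ∈ P, ∑ j, c j * p j ≤ r) ∧ ∀ q ∈ Q, r + 1 ≤ ∑ j, c j * q j := by
  obtain ⟨f, u, w, hu, huw, hw⟩ :=
    geometric_hahn_banach_compact_closed hP hPc hQ hQc.isClosed hPQ
  set y := (InnerProductSpace.toDual ℝ (EuclideanSpace ℝ (Fin d))).symm f with hy
  have hf : ∀ x, f x = ∑ j, y j * x j := fun x => by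
    rw [← InnerProductSpace.toDual_symm_apply (𝕜 := ℝ), ← hy, PiLp.inner_apply]
    exact Finset.sum_congr rfl fun j _ => by simp [mul_comm]
  have hpos : 0 < w - u := by linarith
  have hdiv : ∀ x : EuclideanSpace ℝ (Fin d), ∑ j, y j / (w - u) * x j = f x / (w - u) := fun x => by
    rw [hf, Finset.sum_div]
    exact Finset.sum_congr rfl fun j _ => by ring
  -- Dividing by `w - u` normalizes the gap to 1.
  refine ⟨fun j => y j / (w - u), u / (w - u), fun p hp => ?_, fun q hq => ?_⟩
  · rw [hdiv]
    exact div_le_div_of_nonneg_right (hu p hp).le hpos.le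
  · rw [hdiv, div_add_one hpos.ne']
    refine div_le_div_of_nonneg_right ?_ hpos.le
    linarith [hw q hq]

open Nat in
/-- A separating vector with bounded entries, found as a basic solution of the system of
inequalities that the vertices impose on it. -/
theorem exists_bounded_separating_vector {d M : ℕ} (hM1 : 1 ≤ M)
    {P Q : Set (EuclideanSpace ℝ (Fin d))}
    (hPc : IsCompact P) (hP : Convex ℝ P) (hQc : IsCompact Q) (hQ : Convex ℝ Q)
    (hPQ : Disjoint P Q)
    (hPM : ∀ v ∈ Set.extremePoints ℝ P, HasBoundedFractions M fun j => v j)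
    (hQM : ∀ v ∈ Set.extremePoints ℝ Q, HasBoundedFractions M fun j => v j) :
    ∃ (c : Fin d → ℝ) (r : ℝ), (∀ j, |c j| ≤ (((d + 1) ! * M ^ (d + 1) : ℕ) : ℝ)) ∧
      (∀ p ∈ P, ∑ j, c j * p j ≤ r) ∧ ∀ q ∈ Q, r + 1 ≤ ∑ j, c j * q j := by
  set R : Set (EuclideanSpace ℝ (Fin d)) → Set (ℤ × (Fin d → ℤ)) := fun P =>
    {s | 0 < s.1 ∧ s.1 ≤ M ∧ (∀ j, |s.2 j| ≤ M) ∧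
      ∃ v ∈ Set.extremePoints ℝ P, ∀ j, (s.1 : ℝ) * v j = s.2 j} with hR
  -- Unknown 0 is `r`, the others are `c`. A vertex `z / D` gives `-D r + z · c ≤ 0` for `P` and `D
  -- r - z · c ≤ -D` for `Q`.
  set S : Set ((Fin (d + 1) → ℤ) × ℤ) :=
    (fun s => (Fin.cons (-s.1) s.2, 0)) '' R P ∪
    (fun s => (Fin.cons s.1 (-s.2), -s.1)) '' R Q with hS
  have hsum : ∀ (c : Fin d → ℝ) (s : ℤ × (Fin d → ℤ)) (v : EuclideanSpace ℝ (Fin d)),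
      (∀ j, (s.1 : ℝ) * v j = s.2 j) →
      ∑ j, (s.2 j : ℝ) * c j = s.1 * ∑ j, c j * v j := fun c s v hv => by
    rw [Finset.mul_sum]
    exact Finset.sum_congr rfl fun j _ => by rw [← hv]; ring
  have hSM : ∀ s ∈ S, (∀ j, |s.1 j| ≤ M) ∧ |s.2| ≤ M := by
    rintro _ (⟨⟨D, z⟩, ⟨h0, h1, h2, -⟩, rfl⟩ | ⟨⟨D, z⟩, ⟨h0, h1, h2, -⟩, rfl⟩)
    · refine ⟨fun j => ?_, by simp⟩
      refine Fin.cases ?_ (fun j => ?_) j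
      · simpa [abs_of_pos h0] using h1
      · simpa using h2 j
    · refine ⟨fun j => ?_, by simpa [abs_of_pos h0] using h1⟩
      refine Fin.cases ?_ (fun j => ?_) j
      · simpa [abs_of_pos h0] using h1
      · simpa using h2 j
  obtain ⟨x, hx, hxM⟩ := exists_bounded_solution S M hM1 hSM (by
    obtain ⟨c, r, hcP, hcQ⟩ := exists_separating_vector hPc hP hQc hQ hPQ
    refine ⟨Fin.cons r c, ?_⟩
    rintro _ (⟨⟨D, z⟩, ⟨h0, h1, h2, v, hv, hvz⟩, rfl⟩ | ⟨⟨D, z⟩, ⟨h0, h1, h2, v, hv, hvz⟩, rfl⟩)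
    · have h3 := hsum c (D, z) v hvz
      have h4 := hcP v hv.1
      have h5 : (0 : ℝ) < D := by exact_mod_cast h0
      simp only [Fin.sum_univ_succ, Fin.cons_zero, Fin.cons_succ, h3]
      push_cast
      nlinarith
    · have h3 := hsum c (D, z) v hvz
      have h4 := hcQ v hv.1
      have h5 : (0 : ℝ) < D := by exact_mod_cast h0
      simp only [Fin.sum_univ_succ, Fin.cons_zero, Fin.cons_succ, Pi.neg_apply, Int.cast_neg,
        neg_mul, Finset.sum_neg_distrib, h3]
      nlinarith)
  refine ⟨fun j => x j.succ, x 0, fun j => hxM _, ?_, fun q hq => ?_⟩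
  · refine sum_mul_le_of_extremePoints hPc hP _ _ fun v hv => ?_
    obtain ⟨D, z, h0, h1, h2, h3⟩ := hPM v hv
    have h4 := hx _ (Or.inl ⟨(D, z), ⟨h0, h1, h2, v, hv, h3⟩, rfl⟩)
    have h5 := hsum (fun j => x j.succ) (D, z) v h3
    have h6 : (0 : ℝ) < D := by exact_mod_cast h0
    simp only [Fin.sum_univ_succ, Fin.cons_zero, Fin.cons_succ, h5] at h4
    push_cast at h4
    exact le_of_mul_le_mul_left (by linarith) h6
  · have h7 : ∑ j, -x j.succ * q j ≤ -(x 0 + 1) := by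
      refine sum_mul_le_of_extremePoints hQc hQ (fun j => -x j.succ) _ (fun v hv => ?_) q hq
      obtain ⟨D, z, h0, h1, h2, h3⟩ := hQM v hv
      have h4 := hx _ (Or.inr ⟨(D, z), ⟨h0, h1, h2, v, hv, h3⟩, rfl⟩)
      have h5 := hsum (fun j => x j.succ) (D, z) v h3
      have h6 : (0 : ℝ) < D := by exact_mod_cast h0
      simp only [Fin.sum_univ_succ, Fin.cons_zero, Fin.cons_succ, Pi.neg_apply, Int.cast_neg,
        neg_mul, Finset.sum_neg_distrib, h5] at h4 ⊢
      refine le_of_mul_le_mul_left ?_ h6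
      linarith
    simp only [neg_mul, Finset.sum_neg_distrib] at h7
    linarith

open Nat in
theorem one_le_mul_dist {d M : ℕ} (hM1 : 1 ≤ M) {P Q : Set (EuclideanSpace ℝ (Fin d))}
    (hP : IsRationalPolytope P) (hQ : IsRationalPolytope Q) (hPQ : Disjoint P Q)
    (hPM : ∀ v ∈ Set.extremePoints ℝ P, HasBoundedFractions M fun j => v j)
    (hQM : ∀ v ∈ Set.extremePoints ℝ Q, HasBoundedFractions M fun j => v j)
    {p q : EuclideanSpace ℝ (Fin d)} (hp : p ∈ P) (hq : q ∈ Q) :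
    1 ≤ ((d * ((d + 1) ! * M ^ (d + 1)) : ℕ) : ℝ) * dist p q := by
  obtain ⟨c, r, hc, hcP, hcQ⟩ := exists_bounded_separating_vector hM1 hP.isCompact hP.convex
    hQ.isCompact hQ.convex hPQ hPM hQM
  calc (1 : ℝ) ≤ ∑ j, c j * q j - ∑ j, c j * p j := by linarith [hcP p hp, hcQ q hq]
    _ = ∑ j, c j * (q - p) j := by
      rw [← Finset.sum_sub_distrib]
      exact Finset.sum_congr rfl fun j _ => by rw [PiLp.sub_apply]; ring
    _ ≤ ∑ _j : Fin d, (((d + 1) ! * M ^ (d + 1) : ℕ) : ℝ) * dist p q := by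
      refine Finset.sum_le_sum fun j _ => (le_abs_self _).trans ?_
      rw [abs_mul, _root_.dist_comm, dist_eq_norm]
      refine mul_le_mul (hc j) ?_ (abs_nonneg _) (Nat.cast_nonneg _)
      simpa using PiLp.norm_apply_le (q - p) j
    _ = _ := by
      rw [Finset.sum_const, Finset.card_univ, Fintype.card_fin, nsmul_eq_mul, Nat.cast_mul d,
        mul_assoc]

/-! ### Estimating the exponents -/

open Nat in
theorem eight_mul_le_two_pow {d m : ℕ} (hd : 1 ≤ d) (hm : d ≤ m) :
    8 * (d * ((d + 1) ! * (2 ^ m) ^ (d + 1))) ≤ 2 ^ (m * (2 * d + 6)) := by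
  have h1 : d ≤ 2 ^ m := hm.trans Nat.lt_two_pow_self.le
  have h2 : (d + 1) ! ≤ (2 ^ m) ^ (d + 1) :=
    (Nat.factorial_le_pow (d + 1)).trans (Nat.pow_le_pow_left
      (Nat.lt_two_pow_self.trans_le (Nat.pow_le_pow_right two_pos hm)) _)
  have h3 : 8 ≤ (2 ^ m) ^ 3 :=
    Nat.pow_le_pow_left (Nat.pow_le_pow_right two_pos (hd.trans hm) : 2 ^ 1 ≤ 2 ^ m) 3
  -- The exponents of `2 ^ m` add up to `3 + 1 + 2 * (d + 1) = 2 * d + 6`.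
  calc 8 * (d * ((d + 1) ! * (2 ^ m) ^ (d + 1)))
      ≤ (2 ^ m) ^ 3 * (2 ^ m * ((2 ^ m) ^ (d + 1) * (2 ^ m) ^ (d + 1))) := by gcongr
    _ = 2 ^ (m * (2 * d + 6)) := by
      rw [pow_mul]
      ring

open Nat in
theorem le_setDist {d m E : ℕ} (hm : d ≤ m) (hE : 1 ≤ d → m * (2 * d + 6) ≤ E)
    {P Q : Set (EuclideanSpace ℝ (Fin d))}
    (hP : IsRationalPolytope P) (hQ : IsRationalPolytope Q) (hPQ : Disjoint P Q)
    (hPM : ∀ v ∈ Set.extremePoints ℝ P, HasBoundedFractions (2 ^ m) fun j => v j)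
    (hQM : ∀ v ∈ Set.extremePoints ℝ Q, HasBoundedFractions (2 ^ m) fun j => v j) :
    (8 : ℝ) / 2 ^ E ≤ setDist P Q := by
  refine le_csInf (hP.1.image2 hQ.1) ?_
  rintro _ ⟨p, hp, q, hq, rfl⟩
  have h1 := one_le_mul_dist Nat.one_le_two_pow hP hQ hPQ hPM hQM hp hq
  -- For `d = 0` the previous bound would read `1 ≤ 0`.
  have hd : 1 ≤ d := by
    rcases Nat.eq_zero_or_pos d with rfl | h
    · norm_num at h1
    · exact h
  have h2 : ((8 * (d * ((d + 1) ! * (2 ^ m) ^ (d + 1))) : ℕ) : ℝ) ≤ ((2 ^ E : ℕ) : ℝ) :=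
    Nat.cast_le.2 ((eight_mul_le_two_pow hd hm).trans (Nat.pow_le_pow_right two_pos (hE hd)))
  rw [Nat.cast_mul, Nat.cast_pow] at h2
  rw [div_le_iff₀ (by positivity)]
  push_cast at h1 h2 ⊢
  nlinarith [dist_nonneg (x := p) (y := q)]

open Nat in
theorem factorial_mul_pow_le {d m k : ℕ} (hm : d ≤ m) (hk : k ≤ m) :
    d ! * (2 ^ k) ^ d ≤ 2 ^ (2 * d * m) := by
  have h1 : d ! ≤ (2 ^ m) ^ d := (Nat.factorial_le_pow d).trans
    (Nat.pow_le_pow_left (hm.trans Nat.lt_two_pow_self.le) _)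
  calc d ! * (2 ^ k) ^ d ≤ (2 ^ m) ^ d * (2 ^ m) ^ d := by gcongr; norm_num
    _ = 2 ^ (2 * d * m) := by
      rw [← pow_mul, ← pow_add]
      congr 1
      ring

end RationalPolytope

open RationalPolytope in
theorem mainTheorem5 (d : ℕ) (P Q : Set (EuclideanSpace ℝ (Fin d)))
    (hP : RationalPolytope.IsRationalPolytope P) (hQ : RationalPolytope.IsRationalPolytope Q)
    (hPQ : Disjoint P Q) :
    (8 : ℝ) / 2 ^ (4 * max (RationalPolytope.vertexComplexity P)
        (RationalPolytope.vertexComplexity Q) * (2 * d) ^ 4) ≤ RationalPolytope.setDist P Q ∧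
    (8 : ℝ) / 2 ^ (4 * max (RationalPolytope.facetComplexity P)
        (RationalPolytope.facetComplexity Q) * (2 * d) ^ 6) ≤ RationalPolytope.setDist P Q := by
  constructor
  · obtain ⟨hdP, hvP⟩ := vertexComplexity_spec hP
    obtain ⟨-, hvQ⟩ := vertexComplexity_spec hQ
    refine le_setDist (hdP.trans (le_max_left _ (vertexComplexity Q))) (fun hd => ?_) hP hQ hPQ
      (fun v hv => (hvP v hv).mono (Nat.pow_le_pow_right two_pos (le_max_left _ _)))
      (fun v hv => (hvQ v hv).mono (Nat.pow_le_pow_right two_pos (le_max_right _ _)))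
    have h1 : d ≤ d ^ 4 := Nat.le_self_pow (by norm_num) d
    -- `2 * d + 6 ≤ 8 * d ≤ 64 * d ^ 4`, as `d ≥ 1`.
    calc _ ≤ max (vertexComplexity P) (vertexComplexity Q) * (64 * d ^ 4) := by gcongr; omega
      _ = _ := by ring
  · obtain ⟨hdP, hvP⟩ := facetComplexity_spec hP
    obtain ⟨-, hvQ⟩ := facetComplexity_spec hQ
    have hm := hdP.trans (le_max_left _ (facetComplexity Q))
    -- Cramer's bound on the vertices, `d ! * (2 ^ φ) ^ d`, is at most `2 ^ (2 * d * φ)`.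
    refine le_setDist (m := 2 * d * max (facetComplexity P) (facetComplexity Q)) ?_ (fun hd => ?_)
      hP hQ hPQ (fun v hv => (hvP v hv).mono (factorial_mul_pow_le hm (le_max_left _ _)))
      (fun v hv => (hvQ v hv).mono (factorial_mul_pow_le hm (le_max_right _ _)))
    · rcases Nat.eq_zero_or_pos d with rfl | h
      · simp
      · nlinarith
    · have h1 : d ^ 2 ≤ d ^ 6 := Nat.pow_le_pow_right hd (by norm_num)
      have h2 : d ≤ d ^ 2 := Nat.le_self_pow (by norm_num) d
      calc _ = max (facetComplexity P) (facetComplexity Q) * (4 * d ^ 2 + 12 * d) := by ring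
        _ ≤ max (facetComplexity P) (facetComplexity Q) * (256 * d ^ 6) := by gcongr; omega
        _ = _ := by ring
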